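/- Let $r \geq 1$ and let $A$ be a set with $r$ elements. Let $A_\star = \{a^\star : a \in A\}$ be a disjoint copy of $A$, and extend $a \leftrightarrow a^\star$ to the involution on words over $A \cup A_\star$ with $(xy)^\star = y^\star x^\star$. The free regular $\star$-monoid of rank $r$ is the monoid with presentation \[ \mathbf{F}_r^\star = \operatorname{Mon}\langle A \cup A_\star \mid w w^\star w = w \ \text{ for all words } w \in (A \cup A_\star)^\ast\rangle . \] For a monoid $M$ and a $\mathbb{Z}M$-module $B$, write $H^q(M,B) = \operatorname{Ext}^q_{\mathbb{Z}M}(\mathbb{Z},B)$, where $\mathbb{Z}$ is the trivial module. The trivial cohomological dimension of $M$ is the least integer $k \ge 0$ such that $H^q(M,B) = 0$ for all $q > k$ and all trivial $\mathbb{Z}M$-modules $B$, i.e. all modules on which every element of $M$ acts as the identity ($\infty$ if there is no such $k$). Then $\mathbf{F}_r^\star$ has trivial cohomological dimension exactly $2$. That is, $H^q(\mathbf{F}_r^\star, B) = 0$ for all $q > 2$ and all trivial modules $B$, while $H^2(\mathbf{F}_r^\star, \mathbb{Z}) \neq 0$. This holds both for cohomology defined with left modules and for cohomology defined with right modules. 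-/

import Mathlib

open CategoryTheory

universe u

/-! ### Free regular star-monoids -/

/-- The involution on words over `A ∪ A⋆`: reverse the word and exchange `a` with `a⋆`.
`Sum.inl a` is the letter `a`, and `Sum.inr a` is the letter `a⋆`. -/
def wordStar {A : Type} (w : FreeMonoid (A ⊕ A)) : FreeMonoid (A ⊕ A) :=
  FreeMonoid.ofList ((FreeMonoid.toList w).reverse.map Sum.swap)

/-- The defining relations `w w⋆ w = w`, for all words `w` over `A ∪ A⋆`. -/
inductive StarRel (A : Type) : FreeMonoid (A ⊕ A) → FreeMonoid (A ⊕ A) → Prop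
  | intro (w : FreeMonoid (A ⊕ A)) : StarRel A (w * wordStar w * w) w

/-- The free regular star-monoid on `A`: the monoid presented by the generators `A ∪ A⋆` and
the relations `w w⋆ w = w`. -/
abbrev FreeRegularStarMonoid (A : Type) : Type := PresentedMonoid (StarRel A)

/-! ### Left and right cohomology of a monoid, and trivial cohomological dimension -/

section Cohomology

variable (M : Type) [Monoid M]

/-- The augmentation `ℤM → ℤ`, sending every `m : M` to `1`. -/
noncomputable def augmentation : MonoidAlgebra ℤ M →+* ℤ :=
  (MonoidAlgebra.lift ℤ ℤ M (1 : M →* ℤ)).toRingHom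

/-- The augmentation on the opposite ring. Right `ℤM`-modules are modules over `(ℤM)ᵐᵒᵖ`. -/
noncomputable def augmentationOp : (MonoidAlgebra ℤ M)ᵐᵒᵖ →+* ℤ :=
  (augmentation M).fromOpposite fun _ _ => Commute.all _ _

/-- An abelian group as a trivial left `ℤM`-module: every `m : M` acts as the identity. -/
noncomputable abbrev leftTrivial (B : Type u) [AddCommGroup B] :
    ModuleCat.{u} (MonoidAlgebra ℤ M) :=
  (ModuleCat.restrictScalars (augmentation M)).obj (ModuleCat.of ℤ B)

/-- An abelian group as a trivial right `ℤM`-module: every `m : M` acts as the identity. -/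
noncomputable abbrev rightTrivial (B : Type u) [AddCommGroup B] :
    ModuleCat.{u} (MonoidAlgebra ℤ M)ᵐᵒᵖ :=
  (ModuleCat.restrictScalars (augmentationOp M)).obj (ModuleCat.of ℤ B)

/-- Left cohomology `Ext^q(ℤ, N)` of `M` with coefficients in a left `ℤM`-module `N`. The
module `ℤ` is lifted to the universe of `N`. -/
abbrev LeftCohomology (N : ModuleCat.{u} (MonoidAlgebra ℤ M)) (q : ℕ) : Type u :=
  Abelian.Ext.{u} (leftTrivial M (ULift.{u} ℤ)) N q

/-- Right cohomology `Ext^q(ℤ, N)` of `M` with coefficients in a right `ℤM`-module `N`. -/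
abbrev RightCohomology (N : ModuleCat.{u} (MonoidAlgebra ℤ M)ᵐᵒᵖ) (q : ℕ) : Type u :=
  Abelian.Ext.{u} (rightTrivial M (ULift.{u} ℤ)) N q

/-- The trivial cohomological dimension of `M`, from left cohomology: the least `k` such that
`H^q(M, B) = 0` for all `q > k` and all trivial modules `B` (and `⊤` if there is none). -/
noncomputable def leftTcd : ℕ∞ :=
  sInf {k : ℕ∞ | ∀ q : ℕ, k < q → ∀ (B : Type u) [AddCommGroup B],
    Subsingleton (LeftCohomology M (leftTrivial M B) q)}

/-- The trivial cohomological dimension of `M`, from right cohomology. -/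
noncomputable def rightTcd : ℕ∞ :=
  sInf {k : ℕ∞ | ∀ q : ℕ, k < q → ∀ (B : Type u) [AddCommGroup B],
    Subsingleton (RightCohomology M (rightTrivial M B) q)}

end Cohomology

/-!
The cohomology is computed from an explicit projective resolution of `ℤ` of length two, which lives
on the right Cayley graph of the free regular star-monoid `M`.

*Normal forms.* Call a word reduced if it has no factor `v v⋆ v` with `v` nonempty, and prime if
moreover it is nonempty and has no prefix and no suffix `y y⋆` with `y` nonempty. When a letter `x`
is appended to a reduced word `t`, and `t x` is not reduced, then `t x = q s s⋆ s` for a unique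
nonempty `s`, and this `s` is prime (`prime_of_concat`, `eq_and_eq_of_concat`). Replacing `t x` by
`q s` defines a right action of words on reduced words. It respects the relations `w w⋆ w = w` for
prime `w` (`act_relation_of_prime`), and these imply the relations for all `w`
(`map_relation_of_prime`). Hence `M` acts, and each element of `M` has exactly one reduced
representative. The key fact is `reduced_append_star`: after a reduced word `q w` with `w` prime,
one can walk back along all of `w` without meeting a reduction, unless `q` ends in `w⋆`.

*The resolution.* Normal forms provide a spanning tree of the Cayley graph. An edge `x` at `t` lies
outside the tree exactly when `t x = q s s⋆ s`, and then it closes the loop at `q s` labelled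
`s⋆ s`. So the loops labelled `w⋆ w`, based at the elements `n = n w⋆ w` for prime `w`, generate all
cycles. The loop of `w` at `n` and the loop of `w⋆` at `n w⋆` are the same cycle, and apart from this
coincidence the loops form a basis of the cycles, because exactly one of the two is the loop closed
by a non-tree edge (`homotopy_relator`). With one `w` chosen from each pair `{w, w⋆}`, this makes
`0 → ⨁ ℤM w w⋆ → ⨁ ℤM → ℤM → ℤ → 0` exact, the middle sum being over the letters. Exactness
is shown by an additive contracting homotopy (`edgeBoundary_vertexHomotopy`, `homotopy_edges`,
`homotopy_relators`). As `w w⋆` is idempotent, all terms but `ℤ` are projective. Hence the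
cohomology vanishes above degree two, even with arbitrary coefficients.

*Degree two.* On trivial modules, a map defined on edges takes the relator of `a a` to twice its
value on the relator of the letter `a`. The cocycle which is `0` on the relators of letters and `1`
on all others is therefore not a coboundary (`cocycle_not_extend`).

*Right modules.* The involution of `M` identifies the opposite of the monoid ring with the monoid
ring itself, compatibly with the augmentations, so that the resolution can be transported.
-/

namespace StarWord

variable {A : Type}

/-! ### Reduced words and prime words -/

/-- The involution `w ↦ w⋆` on words, with words regarded as lists of letters. -/
def star (w : List (A ⊕ A)) : List (A ⊕ A) := w.reverse.map Sum.swap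

@[simp] lemma star_nil : star ([] : List (A ⊕ A)) = [] := rfl

@[simp] lemma star_append (v w : List (A ⊕ A)) : star (v ++ w) = star w ++ star v := by
  simp [star]

@[simp] lemma star_star (w : List (A ⊕ A)) : star (star w) = w := by
  simp [star, List.map_reverse]

@[simp] lemma length_star (w : List (A ⊕ A)) : (star w).length = w.length := by
  simp [star]

@[simp] lemma star_eq_nil {w : List (A ⊕ A)} : star w = [] ↔ w = [] := by
  simp [star]

lemma star_injective : Function.Injective (star : List (A ⊕ A) → List (A ⊕ A)) :=
  Function.LeftInverse.injective star_star

/-- A word is reduced if it has no factor `v v⋆ v` with `v` nonempty. Concatenations are nested to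
the right, which is the normal form of `simp`. -/
def Reduced (t : List (A ⊕ A)) : Prop :=
  ∀ p v q, t = p ++ (v ++ (star v ++ (v ++ q))) → v = []

/-- A word is prime if it is nonempty and reduced, and has neither a prefix nor a suffix of the
form `y y⋆` with `y` nonempty. The relations `w w⋆ w = w` with `w` prime suffice to define the
free regular star-monoid. -/
structure Prime (w : List (A ⊕ A)) : Prop where
  ne_nil : w ≠ []
  reduced : Reduced w
  no_prefix : ∀ y z, w = y ++ (star y ++ z) → y = []
  no_suffix : ∀ y z, w = z ++ (y ++ star y) → y = []

lemma Reduced.of_append {p t q : List (A ⊕ A)} (h : Reduced (p ++ (t ++ q))) : Reduced t := by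
  rintro p' v q' rfl
  exact h (p ++ p') v (q' ++ q) (by simp)

lemma Reduced.left {t q : List (A ⊕ A)} (h : Reduced (t ++ q)) : Reduced t :=
  Reduced.of_append (p := []) h

lemma Reduced.right {p t : List (A ⊕ A)} (h : Reduced (p ++ t)) : Reduced t :=
  Reduced.of_append (q := []) (by simpa using h)

lemma reduced_star {t : List (A ⊕ A)} (h : Reduced t) : Reduced (star t) := by
  intro p v q hv
  have h1 : t = star q ++ (star v ++ (star (star v) ++ (star v ++ star p))) := by
    apply star_injective
    simpa using hv
  simpa using h _ _ _ h1

lemma prime_star {w : List (A ⊕ A)} (h : Prime w) : Prime (star w) where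
  ne_nil := by simpa using h.ne_nil
  reduced := reduced_star h.reduced
  no_prefix y z hy := by
    refine h.no_suffix y (star z) ?_
    apply star_injective
    simpa using hy
  no_suffix y z hy := by
    refine h.no_prefix y (star z) ?_
    apply star_injective
    simpa using hy

/-- If `t` is reduced, then a factor `v v⋆ v` of `t x` can only be a suffix. -/
lemma Reduced.eq_nil_of_concat {t p v q : List (A ⊕ A)} {x : A ⊕ A} (h : Reduced t)
    (e : t ++ [x] = p ++ (v ++ (star v ++ (v ++ q)))) (hq : q ≠ []) : v = [] := by
  obtain ⟨q', y, rfl⟩ := List.eq_nil_or_concat q |>.resolve_left hq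
  refine h p v q' ?_
  have e' : t ++ [x] = (p ++ (v ++ (star v ++ (v ++ q')))) ++ [y] := by simpa using e
  exact (List.append_inj' e' rfl).1

lemma reduced_concat {t : List (A ⊕ A)} {x : A ⊕ A} (h : Reduced t)
    (h' : ∀ q s, t ++ [x] = q ++ (s ++ (star s ++ s)) → s = []) : Reduced (t ++ [x]) := by
  intro p v q e
  by_cases hq : q = []
  · subst hq
    exact h' p v (by simpa using e)
  · exact h.eq_nil_of_concat e hq

lemma eq_concat_of_append {t z s : List (A ⊕ A)} {x : A ⊕ A} (hs : s ≠ []) (e : t ++ [x] = z ++ s) :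
    ∃ s', s = s' ++ [x] ∧ t = z ++ s' := by
  obtain ⟨s', y, rfl⟩ := List.eq_nil_or_concat s |>.resolve_left hs
  have e' : t ++ [x] = (z ++ s') ++ [y] := by simpa using e
  obtain ⟨h1, h2⟩ := List.append_inj' e' rfl
  exact ⟨s', by simpa using h2.symm, h1⟩

/-- If the last letter of `t x = q s s⋆ s` completes the first factor of the form `v v⋆ v`, then
`s` is prime. -/
lemma prime_of_concat {t q s : List (A ⊕ A)} {x : A ⊕ A} (h : Reduced t) (hs : s ≠ [])
    (e : t ++ [x] = q ++ (s ++ (star s ++ s))) : Prime s where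
  ne_nil := hs
  reduced := by
    obtain ⟨s', -, ht⟩ := eq_concat_of_append (z := q ++ (s ++ star s)) hs (by simpa using e)
    have : Reduced (q ++ (s ++ (star s ++ s'))) := by simpa [ht] using h
    exact this.of_append
  no_prefix y z hy := by
    by_cases hz : z = []
    · subst hz
      rw [List.append_nil] at hy
      subst hy
      refine h.eq_nil_of_concat (p := q) (q := star y ++ (y ++ star y)) (x := x)
        (by rw [e]; simp) ?_
      intro h0
      simp at h0
      simp [h0] at hs
    · refine h.eq_nil_of_concat (p := q ++ (s ++ star z)) (q := star y ++ z) (x := x) ?_ ?_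
      · rw [e]
        conv_lhs => rw [hy]
        rw [hy]
        simp
      · simp [hz]
  no_suffix y z hy := by
    by_contra hne
    refine hne (h.eq_nil_of_concat (p := q ++ z) (q := star y ++ (star z ++ s)) (x := x) ?_ ?_)
    · rw [e]
      nth_rewrite 1 [hy]
      nth_rewrite 1 [hy]
      simp
    · simp [hne]

lemma eq_of_suffix_of_length_le {q s q' v : List (A ⊕ A)} (hs : Prime s) (hv : Prime v)
    (e : q ++ (s ++ (star s ++ s)) = q' ++ (v ++ (star v ++ v)))
    (hl : s.length ≤ v.length) : s = v := by
  have h1 : (q ++ (s ++ star s)) ++ s = (q' ++ (v ++ star v)) ++ v := by simpa using e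
  rcases List.append_eq_append_iff.1 h1 with ⟨a, ha, rfl⟩ | ⟨v₁, ha, rfl⟩
  · have : a = [] := by
      rw [List.length_append] at hl
      exact List.length_eq_zero_iff.1 (by omega)
    simp [this]
  · -- now `v = v₁ s`, and both `v₁` and `s⋆` are suffixes of the same word
    have h2 : (q ++ s) ++ star s = (q' ++ ((v₁ ++ s) ++ star s ++ star v₁)) ++ v₁ := by
      simpa using ha
    rcases List.append_eq_append_iff.1 h2 with ⟨z, -, hz⟩ | ⟨z, hz, rfl⟩
    · have hz' : s = star v₁ ++ star z := by
        apply star_injective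
        simpa using hz
      have := hv.no_prefix v₁ (star z) (by rw [hz'])
      simp [this]
    · have := hv.no_suffix (star s) z (by simp)
      exact absurd (by simpa using this) hs.ne_nil

/-- The reduction of `t x` at its end is unambiguous. -/
lemma eq_and_eq_of_concat {t q s q' v : List (A ⊕ A)} {x : A ⊕ A} (h : Reduced t)
    (hs : s ≠ []) (hv : v ≠ []) (e : t ++ [x] = q ++ (s ++ (star s ++ s)))
    (e' : t ++ [x] = q' ++ (v ++ (star v ++ v))) : q = q' ∧ s = v := by
  have hs' := prime_of_concat h hs e
  have hv' := prime_of_concat h hv e'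
  have : s = v := by
    rcases le_total s.length v.length with hl | hl
    · exact eq_of_suffix_of_length_le hs' hv' (e ▸ e') hl
    · exact (eq_of_suffix_of_length_le hv' hs' (e' ▸ e) hl).symm
  subst this
  rw [e] at e'
  exact ⟨List.append_cancel_right e', rfl⟩

/-! ### The action on reduced words -/

open Classical in
/-- The right action of a letter `x` on reduced words: append `x`, and if this creates a suffix
`s s⋆ s`, then replace that suffix by `s`. -/
noncomputable def step (t : List (A ⊕ A)) (x : A ⊕ A) : List (A ⊕ A) :=
  if h : ∃ c : List (A ⊕ A) × List (A ⊕ A),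
      c.2 ≠ [] ∧ t ++ [x] = c.1 ++ (c.2 ++ (star c.2 ++ c.2))
    then h.choose.1 ++ h.choose.2 else t ++ [x]

lemma step_eq {t q s : List (A ⊕ A)} {x : A ⊕ A} (h : Reduced t) (hs : s ≠ [])
    (e : t ++ [x] = q ++ (s ++ (star s ++ s))) : step t x = q ++ s := by
  have hex : ∃ c : List (A ⊕ A) × List (A ⊕ A),
      c.2 ≠ [] ∧ t ++ [x] = c.1 ++ (c.2 ++ (star c.2 ++ c.2)) := ⟨(q, s), hs, e⟩
  rw [step, dif_pos hex]
  obtain ⟨h1, h2⟩ := hex.choose_spec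
  obtain ⟨h3, h4⟩ := eq_and_eq_of_concat h hs h1 e h2
  rw [← h3, ← h4]

lemma step_of_reduced {t : List (A ⊕ A)} {x : A ⊕ A} (h : Reduced (t ++ [x])) :
    step t x = t ++ [x] := by
  rw [step, dif_neg]
  rintro ⟨c, hc, e⟩
  exact hc (h c.1 c.2 [] (by simpa using e))

lemma step_cases {t : List (A ⊕ A)} (h : Reduced t) (x : A ⊕ A) :
    (Reduced (t ++ [x]) ∧ step t x = t ++ [x]) ∨
    ∃ q s, Prime s ∧ t ++ [x] = q ++ (s ++ (star s ++ s)) ∧ step t x = q ++ s := by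
  by_cases hr : Reduced (t ++ [x])
  · exact Or.inl ⟨hr, step_of_reduced hr⟩
  · right
    by_contra hcon
    push Not at hcon
    refine hr (reduced_concat h fun q s e => ?_)
    by_contra hs
    exact hcon q s (prime_of_concat h hs e) e (step_eq h hs e)

lemma reduced_step {t : List (A ⊕ A)} (h : Reduced t) (x : A ⊕ A) : Reduced (step t x) := by
  rcases step_cases h x with ⟨hr, e⟩ | ⟨q, s, hs, e, e'⟩
  · rwa [e]
  · obtain ⟨s', -, ht⟩ := eq_concat_of_append (z := q ++ (s ++ star s)) hs.ne_nil (by simpa using e)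
    rw [e']
    refine Reduced.left (q := star s ++ s') ?_
    simpa [ht] using h

/-- The right action of words on reduced words. -/
noncomputable def act (t w : List (A ⊕ A)) : List (A ⊕ A) := w.foldl step t

@[simp] lemma act_nil (t : List (A ⊕ A)) : act t [] = t := rfl

lemma act_append (t v w : List (A ⊕ A)) : act t (v ++ w) = act (act t v) w := by
  simp [act]

lemma act_concat (t v : List (A ⊕ A)) (x : A ⊕ A) : act t (v ++ [x]) = step (act t v) x := by
  simp [act]

lemma reduced_act {t : List (A ⊕ A)} (h : Reduced t) (w : List (A ⊕ A)) : Reduced (act t w) := by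
  induction w using List.reverseRecOn with
  | nil => exact h
  | append_singleton w x ih => rw [act_concat]; exact reduced_step ih x

lemma act_of_reduced {t w : List (A ⊕ A)} (h : Reduced (t ++ w)) : act t w = t ++ w := by
  induction w using List.reverseRecOn with
  | nil => simp
  | append_singleton w x ih =>
    have h' : Reduced ((t ++ w) ++ [x]) := by simpa using h
    rw [act_concat, ih h'.left, step_of_reduced h', List.append_assoc]

/-- A prime word has no proper overlap with a word folded back on itself: if `z u` is prime and
`z`, `u⋆` are suffixes of the same word, then one of `z`, `u` is empty. -/
lemma Prime.eq_nil_or_eq_nil {z u X Y : List (A ⊕ A)} (hw : Prime (z ++ u))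
    (e : X ++ star u = Y ++ z) : z = [] ∨ u = [] := by
  rcases List.append_eq_append_iff.1 e with ⟨a, -, ha⟩ | ⟨a, -, rfl⟩
  · left
    have hu : u = star z ++ star a := by
      apply star_injective
      simpa using ha
    exact hw.no_prefix z (star a) (by rw [hu])
  · right
    simpa using hw.no_suffix (star u) a (by simp)

/-- Acting by a prime word (more generally, by a reduced word without a prefix `y y⋆`) produces a
word ending in it. -/
lemma exists_act_eq_append {w : List (A ⊕ A)} (hw : Reduced w)
    (hp : ∀ y z, w = y ++ (star y ++ z) → y = []) {t : List (A ⊕ A)} (ht : Reduced t) :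
    ∃ q, act t w = q ++ w := by
  induction w using List.reverseRecOn with
  | nil => exact ⟨t, by simp⟩
  | append_singleton p x ih =>
    obtain ⟨q, hq⟩ := ih hw.left fun y z e => hp y (z ++ [x]) (by simp [e])
    have hr := reduced_act ht p
    rw [act_concat]
    rcases step_cases hr x with ⟨-, e⟩ | ⟨r, s, hs, e, e'⟩
    · exact ⟨q, by rw [e, hq, List.append_assoc]⟩
    · rw [e']
      rw [hq] at e
      have h1 : q ++ (p ++ [x]) = (r ++ (s ++ star s)) ++ s := by simpa using e
      rcases List.append_eq_append_iff.1 h1 with ⟨z, hz', hz⟩ | ⟨z, hz', hz⟩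
      · -- `p x = z s` where `z` ends in `s⋆` or is an end of it
        rw [hz] at hp hw ⊢
        have h2 : (r ++ s) ++ star s = q ++ z := by simpa using hz'
        rcases List.append_eq_append_iff.1 h2 with ⟨a, -, ha⟩ | ⟨a, h3, rfl⟩
        · have hs' : s = star z ++ star a := by
            apply star_injective
            simpa using ha
          have hz0 : z = [] := hp z (star a) (by rw [hs'])
          exact ⟨r, by simp [hz0]⟩
        · rcases List.append_eq_append_iff.1 h3 with ⟨b, -, hb⟩ | ⟨b, -, rfl⟩
          · rcases eq_or_ne a [] with rfl | ha
            · exact absurd (hp (star s) [] (by simp)) (by simpa using hs.ne_nil)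
            · refine absurd (hp a (star b ++ s) ?_) ha
              rw [hb]
              simp
          · exact absurd (hw b s [] (by simp)) hs.ne_nil
      · exact ⟨r ++ z, by rw [hz]; simp⟩

/-- If `q w` is reduced with `w` prime, then walking back along `w` from `q w` meets no reduction,
except possibly at the last letter, and there only if `q` ends in `w⋆`. -/
lemma reduced_append_star {q w : List (A ⊕ A)} (hw : Prime w) (hr : Reduced (q ++ w)) :
    ∀ u v : List (A ⊕ A), w = v ++ u → (v ≠ [] ∨ ∀ q', q ≠ q' ++ star w) →
      Reduced (q ++ w ++ star u)
  | [], v, _, _ => by simpa using hr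
  | x :: u, v, hvu, hv => by
    have ih := reduced_append_star hw hr u (v ++ [x]) (by simpa using hvu) (by simp)
    have hstar : star (x :: u) = star u ++ [x.swap] := by simp [star]
    have hgoal : q ++ w ++ star (x :: u) = (q ++ w ++ star u) ++ [x.swap] := by simp [hstar]
    rw [hgoal]
    refine reduced_concat ih fun q' s e => ?_
    by_contra hs0
    have hs := prime_of_concat ih hs0 e
    rw [← hgoal] at e
    generalize hu : x :: u = u' at *
    have hu0 : u' ≠ [] := by simp [← hu]
    subst hvu
    -- the suffix `s` cannot be equal to `u'⋆`
    have key : q' ++ s = q ++ v → s = star u' → False := by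
      rintro h1 rfl
      rcases hw.eq_nil_or_eq_nil h1 with rfl | h
      · exact hv.elim (· rfl) fun h => h q' (by simpa using h1.symm)
      · exact hu0 h
    have e1 : (q ++ (v ++ u')) ++ star u' = (q' ++ (s ++ star s)) ++ s := by simpa using e
    rcases List.append_eq_append_iff.1 e1 with ⟨a, ha, ha'⟩ | ⟨a, ha, rfl⟩
    · -- the suffix `s` of `u'⋆ = a s` does not reach beyond `u'⋆`
      have hu' : u' = star s ++ star a := by
        apply star_injective
        simpa using ha'
      have e2 : (q' ++ s) ++ star s = (q ++ v ++ star s ++ star a) ++ a := by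
        rw [hu'] at ha
        simpa using ha
      rcases List.append_eq_append_iff.1 e2 with ⟨b, hb, hb'⟩ | ⟨b, hb, rfl⟩
      · have ha0 : a = [] := by
          simpa using hw.no_suffix a (v ++ b) (by rw [hu', hb']; simp)
        subst ha0
        refine key ?_ (by simpa using ha'.symm)
        have : (q' ++ s) ++ star s = (q ++ v) ++ star s := by simpa using e2
        exact List.append_cancel_right this
      · rcases eq_or_ne b [] with rfl | hb0
        · have := hw.no_suffix (star s) v (by rw [hu']; simp)
          exact hs0 (by simpa using this)
        · have e3 : (q ++ v ++ star s ++ s) ++ star b ++ b = q' ++ s := by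
            rw [hb]
            simp
          rcases List.append_eq_append_iff.1 e3 with ⟨c, -, rfl⟩ | ⟨c, hc, rfl⟩
          · refine hs0 (reduced_star hw.reduced.right c s [] ?_)
            simpa using ha'
          · rcases hs.eq_nil_or_eq_nil hc with rfl | h
            · refine hb0 (reduced_star hw.reduced.right [] b [] ?_)
              simpa using ha'
            · exact hb0 h
    · -- the suffix `s = a u'⋆` contains all of `u'⋆`
      rcases hs.eq_nil_or_eq_nil (X := q ++ v) (Y := q' ++ (a ++ star u') ++ star (a ++ star u'))
        (by simpa using ha) with rfl | h
      · refine key ?_ rfl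
        have : (q' ++ star u') ++ u' = (q ++ v) ++ u' := by simpa using ha.symm
        simpa using List.append_cancel_right this
      · exact hu0 (by simpa using h)

/-! ### The defining relations -/

lemma act_star_of_not_suffix {q w : List (A ⊕ A)} (hw : Prime w) (hr : Reduced (q ++ w))
    (hq : ∀ q', q ≠ q' ++ star w) : act (q ++ w) (star w) = q ++ w ++ star w :=
  act_of_reduced (reduced_append_star hw hr w [] rfl (Or.inr hq))

lemma act_star_of_suffix {q w : List (A ⊕ A)} (hw : Prime w)
    (hr : Reduced (q ++ star w ++ w)) : act (q ++ star w ++ w) (star w) = q ++ star w := by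
  obtain ⟨x, w', rfl⟩ := List.exists_cons_of_ne_nil hw.ne_nil
  have h1 := reduced_append_star hw hr w' [x] rfl (by simp)
  have hstar : star (x :: w') = star w' ++ [x.swap] := by simp [star]
  have h2 : act (q ++ star (x :: w') ++ x :: w') (star (x :: w')) =
      step (act (q ++ star (x :: w') ++ x :: w') (star w')) x.swap := by
    conv_lhs => enter [2]; rw [hstar]
    rw [act_concat]
  rw [h2, act_of_reduced h1]
  refine step_eq h1 (s := star (x :: w')) (by simp) ?_
  conv_rhs => rw [star_star]
  simp [hstar]

lemma not_suffix_of_reduced {q w : List (A ⊕ A)} (hw : w ≠ []) (hr : Reduced (q ++ star w ++ w)) :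
    ∀ q', q ≠ q' ++ w := by
  rintro q' rfl
  exact hw (hr q' w [] (by simp))

lemma act_relation_of_prime {t w : List (A ⊕ A)} (hw : Prime w) (ht : Reduced t) :
    act t (w ++ star w ++ w) = act t w := by
  obtain ⟨q, hq⟩ := exists_act_eq_append hw.reduced hw.no_prefix ht
  have hr : Reduced (q ++ w) := hq ▸ reduced_act ht w
  rw [act_append, act_append, hq]
  by_cases h : ∃ q', q = q' ++ star w
  · obtain ⟨q', rfl⟩ := h
    rw [act_star_of_suffix hw hr]
    exact act_of_reduced hr
  · push Not at h
    have h1 : Reduced (q ++ w ++ star w) := reduced_append_star hw hr w [] rfl (Or.inr h)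
    rw [act_star_of_not_suffix hw hr h]
    have := act_star_of_suffix (prime_star hw) (q := q) (by simpa using h1)
    simpa using this

/-- If a monoid homomorphism from words satisfies the relations `w w⋆ w = w` for prime `w`, then it
satisfies them for all `w`. -/
lemma map_relation_of_prime {N : Type*} [Monoid N] (φ : FreeMonoid (A ⊕ A) →* N)
    (h : ∀ w : List (A ⊕ A), Prime w →
      φ (FreeMonoid.ofList (w ++ star w ++ w)) = φ (FreeMonoid.ofList w)) :
    ∀ w : List (A ⊕ A), φ (FreeMonoid.ofList (w ++ star w ++ w)) = φ (FreeMonoid.ofList w) := by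
  set f : List (A ⊕ A) → N := fun w => φ (FreeMonoid.ofList w) with hf
  have mul : ∀ v w, f (v ++ w) = f v * f w := fun v w => by
    simp only [hf, FreeMonoid.ofList_append, map_mul]
  intro w
  change f _ = f _
  induction hn : w.length using Nat.strong_induction_on generalizing w with
  | _ n ih =>
    subst hn
    replace ih : ∀ v : List (A ⊕ A), v.length < w.length → f v * (f (star v) * f v) = f v := by
      intro v hv
      conv_rhs => rw [← ih _ hv v rfl, mul, mul, mul_assoc]
    have ih' : ∀ v : List (A ⊕ A), v.length < w.length → ∀ c,
        f v * (f (star v) * (f v * c)) = f v * c := by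
      intro v hv c
      rw [← mul_assoc (f (star v)), ← mul_assoc (f v), ih v hv]
    by_cases hw : w = []
    · subst hw; rfl
    by_cases hred : Reduced w
    · by_cases hpre : ∀ y z, w = y ++ (star y ++ z) → y = []
      · by_cases hsuf : ∀ y z, w = z ++ (y ++ star y) → y = []
        · exact h w ⟨hw, hred, hpre, hsuf⟩
        · push Not at hsuf
          obtain ⟨y, z, rfl, hy⟩ := hsuf
          have hl := List.length_pos_iff.2 hy
          have h1 := ih' y (by simp; omega)
          have h2 := ih' (z ++ y) (by simp; omega) (f (star y))
          simp only [mul, star_append, star_star, mul_assoc] at h1 h2 ⊢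
          rw [h1, h2]
      · push Not at hpre
        obtain ⟨y, z, rfl, hy⟩ := hpre
        have hl := List.length_pos_iff.2 hy
        have h1 := ih' y (by simp; omega)
        have h2 := ih (star y ++ z) (by simp; omega)
        simp only [mul, star_append, star_star, mul_assoc] at h1 h2 ⊢
        rw [h1, h2]
    · simp only [Reduced] at hred
      push Not at hred
      obtain ⟨p, v, q, rfl, hv⟩ := hred
      have hl := List.length_pos_iff.2 hv
      have h1 := ih' v (by simp; omega)
      have h2 := ih' (star v) (by simp; omega)
      have h3 := ih (p ++ (v ++ q)) (by simp; omega)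
      simp only [mul, star_append, star_star, mul_assoc] at h1 h2 h3 ⊢
      rw [h1, h2, h1, h3]

/-! ### Normal forms -/

/-- The element of the free regular star-monoid represented by a word. -/
def cls (w : List (A ⊕ A)) : FreeRegularStarMonoid A :=
  PresentedMonoid.mk (StarRel A) (FreeMonoid.ofList w)

@[simp] lemma cls_nil : cls ([] : List (A ⊕ A)) = 1 := rfl

@[simp] lemma cls_append (v w : List (A ⊕ A)) : cls (v ++ w) = cls v * cls w := rfl

lemma cls_cons (x : A ⊕ A) (w : List (A ⊕ A)) : cls (x :: w) = cls [x] * cls w := rfl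

lemma cls_surjective : Function.Surjective (cls : List (A ⊕ A) → FreeRegularStarMonoid A) :=
  PresentedMonoid.surjective_mk

lemma cls_mul_star_mul (w : List (A ⊕ A)) : cls w * cls (star w) * cls w = cls w :=
  PresentedMonoid.mk_eq_mk_of_rel (StarRel.intro (FreeMonoid.ofList w))

/-- The right action of a letter, as a self-map of the set of reduced words. -/
noncomputable def letterAct (x : A ⊕ A) :
    (Function.End {t : List (A ⊕ A) // Reduced t})ᵐᵒᵖ :=
  MulOpposite.op (fun t => ⟨step t.1 x, reduced_step t.2 x⟩ :
    {t : List (A ⊕ A) // Reduced t} → {t : List (A ⊕ A) // Reduced t})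

/-- The action of words on the set of reduced words, as a homomorphism. -/
noncomputable def actHom (A : Type) :
    FreeMonoid (A ⊕ A) →* (Function.End {t : List (A ⊕ A) // Reduced t})ᵐᵒᵖ :=
  FreeMonoid.lift letterAct

lemma actHom_apply (w : List (A ⊕ A)) (t : {t : List (A ⊕ A) // Reduced t}) :
    (((actHom A (FreeMonoid.ofList w)).unop : _ → _) t).1 = act t.1 w := by
  induction w generalizing t with
  | nil => rfl
  | cons x w ih =>
    rw [FreeMonoid.ofList_cons, map_mul, MulOpposite.unop_mul]
    exact ih _

lemma actHom_relation (w : List (A ⊕ A)) :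
    actHom A (FreeMonoid.ofList (w ++ star w ++ w)) = actHom A (FreeMonoid.ofList w) := by
  refine map_relation_of_prime _ (fun w hw => ?_) w
  apply MulOpposite.unop_injective
  funext t
  apply Subtype.ext
  rw [actHom_apply, actHom_apply, act_relation_of_prime hw t.2]

/-- The right action of the free regular star-monoid on the set of reduced words. -/
noncomputable def monoidAct (A : Type) :
    FreeRegularStarMonoid A →* (Function.End {t : List (A ⊕ A) // Reduced t})ᵐᵒᵖ :=
  PresentedMonoid.lift letterAct (by
    rintro _ w ⟨⟩
    exact actHom_relation w)

lemma reduced_nil : Reduced ([] : List (A ⊕ A)) := by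
  intro p v q h
  have := congrArg List.length h
  simp at this
  exact List.length_eq_zero_iff.1 (by omega)

/-- The normal form of an element: the unique reduced word representing it, obtained by acting on
the empty word. -/
noncomputable def nf (m : FreeRegularStarMonoid A) : List (A ⊕ A) :=
  (((monoidAct A m).unop : _ → _) ⟨[], reduced_nil⟩).1

lemma nf_cls (w : List (A ⊕ A)) : nf (cls w) = act [] w := actHom_apply w ⟨[], reduced_nil⟩

lemma reduced_nf (m : FreeRegularStarMonoid A) : Reduced (nf m) :=
  (((monoidAct A m).unop : _ → _) ⟨[], reduced_nil⟩).2

lemma nf_mul_cls (m : FreeRegularStarMonoid A) (w : List (A ⊕ A)) :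
    nf (m * cls w) = act (nf m) w := by
  obtain ⟨v, rfl⟩ := cls_surjective m
  rw [← cls_append, nf_cls, nf_cls, act_append]

lemma nf_cls_of_reduced {w : List (A ⊕ A)} (hw : Reduced w) : nf (cls w) = w := by
  rw [nf_cls, act_of_reduced (by simpa using hw), List.nil_append]

lemma cls_step {t : List (A ⊕ A)} (ht : Reduced t) (x : A ⊕ A) :
    cls (step t x) = cls (t ++ [x]) := by
  rcases step_cases ht x with ⟨-, e⟩ | ⟨q, s, -, e, e'⟩
  · rw [e]
  · rw [e, e', cls_append, cls_append, cls_append, cls_append, ← mul_assoc (cls s),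
      cls_mul_star_mul]

@[simp] lemma cls_nf (m : FreeRegularStarMonoid A) : cls (nf m) = m := by
  obtain ⟨w, rfl⟩ := cls_surjective m
  rw [nf_cls]
  induction w using List.reverseRecOn with
  | nil => rfl
  | append_singleton w x ih =>
    rw [act_concat, cls_step (reduced_act reduced_nil w), cls_append, ih, cls_append]

lemma nf_mul_cls_of_reduced {m : FreeRegularStarMonoid A} {w : List (A ⊕ A)}
    (h : Reduced (nf m ++ w)) : nf (m * cls w) = nf m ++ w := by
  rw [nf_mul_cls, act_of_reduced h]

/-! ### Orienting the prime words -/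

/-- No letter is fixed by the involution, so a word with `w = w⋆` has the form `y y⋆`. -/
lemma Prime.ne_star {w : List (A ⊕ A)} (hw : Prime w) : w ≠ star w := by
  intro h
  set y := w.take (w.length / 2) with hy
  set z := w.drop (w.length / 2) with hz
  have hyz : w = y ++ z := (List.take_append_drop _ _).symm
  have hyl : y.length = w.length / 2 := by simp [hy]; omega
  have hzl : z.length = w.length - w.length / 2 := by simp [hz]
  have e : y ++ z = star z ++ star y := by
    rw [← star_append, ← hyz, ← h]
  rcases Nat.even_or_odd' w.length with ⟨k, hk | hk⟩
  · obtain ⟨-, h2⟩ := List.append_inj e (by simp; omega)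
    have hy0 := hw.no_prefix y [] (by rw [List.append_nil, ← h2, ← hyz])
    have : w.length = 0 := by
      rw [hy0] at hyl
      simp at hyl
      omega
    exact hw.ne_nil (List.length_eq_zero_iff.1 this)
  · -- the middle letter would be fixed by the involution
    obtain ⟨x, z', hz'⟩ : ∃ x z', z = x :: z' :=
      List.exists_cons_of_ne_nil (by rw [← List.length_pos_iff]; omega)
    rw [hz'] at e hzl
    have e' : y ++ ([x] ++ z') = star z' ++ ([x.swap] ++ star y) := by
      simpa [star] using e
    simp at hzl
    obtain ⟨-, h2⟩ := List.append_inj e' (by simp; omega)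
    have h3 : x = x.swap := by simpa using congrArg List.head? h2
    cases x <;> simp at h3

/-- A choice of one word from each pair `{w, w⋆}` of prime words, made by an auxiliary
well-ordering of all words. -/
structure Positive (w : List (A ⊕ A)) : Prop where
  prime : Prime w
  rel : WellOrderingRel w (star w)

lemma Positive.not_star {w : List (A ⊕ A)} (hw : Positive w) : ¬ Positive (star w) := by
  intro h
  have h1 := h.rel
  rw [star_star] at h1
  exact asymm h1 hw.rel

lemma Prime.positive_or {w : List (A ⊕ A)} (hw : Prime w) : Positive w ∨ Positive (star w) := by
  rcases trichotomous_of WellOrderingRel w (star w) with h | h | h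
  · exact Or.inl ⟨hw, h⟩
  · exact absurd h hw.ne_star
  · exact Or.inr ⟨prime_star hw, by rwa [star_star]⟩

/-! ### The resolution -/

/-- The monoid ring of the free regular star-monoid. -/
abbrev MonoidRing (A : Type) : Type := MonoidAlgebra ℤ (FreeRegularStarMonoid A)

/-- The edges of the right Cayley graph, as a free module with one generator for each letter. -/
abbrev Edges (A : Type) : Type := (A ⊕ A) →₀ MonoidRing A

/-- The free module with one generator for each pair `{w, w⋆}` of prime words. -/
abbrev Relators (A : Type) : Type := {w : List (A ⊕ A) // Positive w} →₀ MonoidRing A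

/-- An element of the monoid as a basis element of the monoid ring. -/
noncomputable def bas (m : FreeRegularStarMonoid A) : MonoidRing A := MonoidAlgebra.single m 1

lemma bas_mul (m n : FreeRegularStarMonoid A) : bas (m * n) = bas m * bas n := by
  simp [bas]

lemma bas_one : bas (1 : FreeRegularStarMonoid A) = 1 := rfl

lemma bas_smul_smul {N : Type*} [AddCommGroup N] [Module (MonoidRing A) N]
    (m n : FreeRegularStarMonoid A) (k : N) : bas m • bas n • k = bas (m * n) • k := by
  rw [smul_smul, bas_mul]

/-- The additive map on the monoid ring with given values on the elements of the monoid. -/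
noncomputable def extend {N : Type*} [AddCommGroup N] (f : FreeRegularStarMonoid A → N) :
    MonoidRing A →+ N :=
  (Finsupp.liftAddHom fun m => zmultiplesHom N (f m)).comp
    (MonoidAlgebra.coeffAddEquiv : MonoidRing A ≃+ _).toAddMonoidHom

@[simp] lemma extend_bas {N : Type*} [AddCommGroup N] (f : FreeRegularStarMonoid A → N)
    (m : FreeRegularStarMonoid A) : extend f (bas m) = f m := by
  simp [extend, bas]

lemma ring_addHom_ext {N : Type*} [AddCommGroup N] {f g : MonoidRing A →+ N}
    (h : ∀ m, f (bas m) = g (bas m)) : f = g := by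
  apply MonoidAlgebra.addHom_ext'
  intro m
  ext
  exact h m

lemma finsupp_addHom_ext {ι : Type*} {N : Type*} [AddCommGroup N] {f g : (ι →₀ MonoidRing A) →+ N}
    (h : ∀ (i : ι) (m : FreeRegularStarMonoid A),
      f (bas m • Finsupp.single i (1 : MonoidRing A)) =
        g (bas m • Finsupp.single i (1 : MonoidRing A))) :
    f = g := by
  apply Finsupp.addHom_ext'
  intro i
  apply ring_addHom_ext
  intro m
  simpa using h i m

/-- The Fox derivative of a word: the path that it spells in the Cayley graph, starting at `1`. -/
noncomputable def fox : List (A ⊕ A) → Edges A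
  | [] => 0
  | x :: w => Finsupp.single x 1 + bas (cls [x]) • fox w

@[simp] lemma fox_nil : fox ([] : List (A ⊕ A)) = 0 := rfl

@[simp] lemma fox_singleton (x : A ⊕ A) : fox [x] = Finsupp.single x 1 := by
  simp [fox]

lemma fox_append (v w : List (A ⊕ A)) : fox (v ++ w) = fox v + bas (cls v) • fox w := by
  induction v with
  | nil => simp [bas_one]
  | cons x v ih =>
    rw [List.cons_append, fox, ih, fox, cls_cons x v, smul_add, bas_smul_smul, add_assoc]

/-- The boundary of an edge: the edge labelled `x` at `m` leads from `m` to `m x`. -/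
noncomputable def edgeBoundary (A : Type) : Edges A →ₗ[MonoidRing A] MonoidRing A :=
  Finsupp.linearCombination (MonoidRing A) fun x => bas (cls [x]) - 1

lemma edgeBoundary_fox (w : List (A ⊕ A)) : edgeBoundary A (fox w) = bas (cls w) - 1 := by
  induction w with
  | nil => simp [bas_one]
  | cons x w ih =>
    rw [fox, map_add, map_smul, ih, cls_cons x w, bas_mul]
    simp [edgeBoundary, mul_sub]

/-- The boundary of the `2`-cell of a prime word `w`: the loop labelled `w⋆ w` at `w`. -/
noncomputable def relatorBoundary (A : Type) : Relators A →ₗ[MonoidRing A] Edges A :=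
  Finsupp.linearCombination (MonoidRing A) fun w => bas (cls w.1) • fox (star w.1 ++ w.1)

/-- The idempotent endomorphism of the module of relators which multiplies the generator of `w` by
`w w⋆`. Its image is a sum of principal left ideals, one for each pair `{w, w⋆}` of prime words. -/
noncomputable def relatorProj (A : Type) : Relators A →ₗ[MonoidRing A] Relators A :=
  Finsupp.linearCombination (MonoidRing A) fun w =>
    bas (cls (w.1 ++ star w.1)) • Finsupp.single w 1

lemma relatorBoundary_single (m : FreeRegularStarMonoid A) (w : {w : List (A ⊕ A) // Positive w}) :
    relatorBoundary A (bas m • Finsupp.single w 1) =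
      bas (m * cls w.1) • fox (star w.1 ++ w.1) := by
  simp [relatorBoundary, smul_smul, bas_mul]

lemma relatorProj_single (m : FreeRegularStarMonoid A) (w : {w : List (A ⊕ A) // Positive w}) :
    relatorProj A (bas m • Finsupp.single w 1) =
      bas (m * cls w.1 * cls (star w.1)) • Finsupp.single w 1 := by
  rw [map_smul, relatorProj, Finsupp.linearCombination_single, one_smul, bas_smul_smul, cls_append,
    mul_assoc]

lemma edgeBoundary_relatorBoundary (l : Relators A) :
    edgeBoundary A (relatorBoundary A l) = 0 := by
  have : (edgeBoundary A).comp (relatorBoundary A) = 0 := by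
    apply Finsupp.lhom_ext'
    intro w
    ext
    have h := relatorBoundary_single 1 w
    rw [bas_one, one_smul] at h
    simp only [LinearMap.comp_apply, Finsupp.lsingle_apply]
    rw [h, map_smul, edgeBoundary_fox]
    rw [smul_eq_mul, mul_sub, mul_one, ← bas_mul, one_mul, cls_append, ← mul_assoc,
      cls_mul_star_mul, sub_self]
    simp
  exact LinearMap.congr_fun this l

open Classical in
/-- The `2`-cell bounded by the loop labelled `s⋆ s` at the vertex `c`, where `s` is prime and
`c = c s⋆ s`. The last branch is a default value, not taken for prime `s`. -/
noncomputable def cell (s : List (A ⊕ A)) (c : FreeRegularStarMonoid A) : Relators A :=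
  if h : Positive s then bas (c * cls (star s)) • Finsupp.single ⟨s, h⟩ 1
  else if h : Positive (star s) then bas c • Finsupp.single ⟨star s, h⟩ 1
  else 0

lemma relatorBoundary_cell {s : List (A ⊕ A)} (hs : Prime s) {c : FreeRegularStarMonoid A}
    (hc : c * cls (star s) * cls s = c) :
    relatorBoundary A (cell s c) = bas c • fox (star s ++ s) := by
  rw [cell]
  split_ifs with h h'
  · rw [relatorBoundary_single, hc]
  · rw [relatorBoundary_single, fox_append, fox_append, star_star, smul_add, smul_add,
      bas_smul_smul, bas_smul_smul, hc, add_comm]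
  · exact (hs.positive_or.elim h h').elim

open Classical in
/-- The contracting homotopy on edges: an edge of the spanning tree of normal forms goes to `0`, and
any other edge goes to the `2`-cell of the loop that it closes. -/
noncomputable def edgeCell (x : A ⊕ A) (m : FreeRegularStarMonoid A) : Relators A :=
  if h : ∃ c : List (A ⊕ A) × List (A ⊕ A),
      c.2 ≠ [] ∧ nf m ++ [x] = c.1 ++ (c.2 ++ (star c.2 ++ c.2))
    then cell h.choose.2 (cls (h.choose.1 ++ h.choose.2)) else 0

lemma edgeCell_eq {x : A ⊕ A} {m : FreeRegularStarMonoid A} {q s : List (A ⊕ A)} (hs : s ≠ [])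
    (e : nf m ++ [x] = q ++ (s ++ (star s ++ s))) : edgeCell x m = cell s (cls (q ++ s)) := by
  have hex : ∃ c : List (A ⊕ A) × List (A ⊕ A),
      c.2 ≠ [] ∧ nf m ++ [x] = c.1 ++ (c.2 ++ (star c.2 ++ c.2)) := ⟨(q, s), hs, e⟩
  rw [edgeCell, dif_pos hex]
  obtain ⟨h1, h2⟩ := hex.choose_spec
  obtain ⟨h3, h4⟩ := eq_and_eq_of_concat (reduced_nf m) hs h1 e h2
  rw [← h3, ← h4]

lemma edgeCell_of_reduced {x : A ⊕ A} {m : FreeRegularStarMonoid A}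
    (h : Reduced (nf m ++ [x])) : edgeCell x m = 0 := by
  rw [edgeCell, dif_neg]
  rintro ⟨c, hc, e⟩
  exact hc (h c.1 c.2 [] (by simpa using e))

/-- The contracting homotopy from vertices to edges: a vertex goes to the path spelled by its
normal form. -/
noncomputable def vertexHomotopy (A : Type) : MonoidRing A →+ Edges A := extend fun m => fox (nf m)

/-- The contracting homotopy from edges to `2`-cells. -/
noncomputable def edgeHomotopy (A : Type) : Edges A →+ Relators A :=
  Finsupp.liftAddHom fun x => extend (edgeCell x)

lemma edgeHomotopy_single (x : A ⊕ A) (m : FreeRegularStarMonoid A) :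
    edgeHomotopy A (bas m • Finsupp.single x 1) = edgeCell x m := by
  simp [edgeHomotopy]

lemma augmentation_bas (m : FreeRegularStarMonoid A) :
    augmentation (FreeRegularStarMonoid A) (bas m) = 1 := by
  simp [augmentation, bas]

lemma edgeBoundary_vertexHomotopy (k : MonoidRing A) :
    edgeBoundary A (vertexHomotopy A k) =
      k - augmentation (FreeRegularStarMonoid A) k • (1 : MonoidRing A) := by
  have : ((edgeBoundary A).toAddMonoidHom.comp (vertexHomotopy A)) =
      AddMonoidHom.id _ - (((zmultiplesHom _) (1 : MonoidRing A)).comp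
        (augmentation (FreeRegularStarMonoid A)).toAddMonoidHom) := by
    apply ring_addHom_ext
    intro m
    simp [vertexHomotopy, edgeBoundary_fox, augmentation_bas]
  exact DFunLike.congr_fun this k

lemma homotopy_edge (x : A ⊕ A) (m : FreeRegularStarMonoid A) :
    relatorBoundary A (edgeCell x m) + (fox (nf (m * cls [x])) - fox (nf m)) =
      bas m • Finsupp.single x 1 := by
  have hfox : fox (nf m ++ [x]) = fox (nf m) + bas m • Finsupp.single x 1 := by
    rw [fox_append, cls_nf, fox_singleton]
  have hnf : nf (m * cls [x]) = step (nf m) x := by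
    rw [nf_mul_cls]
    rfl
  rw [hnf]
  rcases step_cases (reduced_nf m) x with ⟨hr, e⟩ | ⟨q, s, hs, e, e'⟩
  · rw [e, edgeCell_of_reduced hr, hfox]
    simp
  · have hc : cls (q ++ s) * cls (star s) * cls s = cls (q ++ s) := by
      rw [cls_append, mul_assoc, mul_assoc, ← mul_assoc (cls s), cls_mul_star_mul]
    rw [e', edgeCell_eq hs.ne_nil e, relatorBoundary_cell hs hc]
    rw [e, ← List.append_assoc, fox_append] at hfox
    rw [eq_sub_of_add_eq' hfox]
    abel

/-- Exactness at the edges. -/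
lemma homotopy_edges (k : Edges A) :
    relatorBoundary A (edgeHomotopy A k) + vertexHomotopy A (edgeBoundary A k) = k := by
  have : (relatorBoundary A).toAddMonoidHom.comp (edgeHomotopy A) +
      (vertexHomotopy A).comp (edgeBoundary A).toAddMonoidHom = AddMonoidHom.id _ := by
    apply finsupp_addHom_ext
    intro x m
    have h := edgeHomotopy_single x m
    have h' : edgeBoundary A (bas m • Finsupp.single x 1) = bas (m * cls [x]) - bas m := by
      simp [edgeBoundary, mul_sub, bas_mul]
    have h'' := homotopy_edge x m
    simp only [AddMonoidHom.add_apply, AddMonoidHom.comp_apply, LinearMap.toAddMonoidHom_coe, h, h',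
      AddMonoidHom.id_apply, vertexHomotopy, map_sub, extend_bas]
    exact h''
  exact DFunLike.congr_fun this k

/-- Paths in the spanning tree of normal forms are killed by the homotopy. -/
lemma edgeHomotopy_path {m : FreeRegularStarMonoid A} {u : List (A ⊕ A)}
    (h : Reduced (nf m ++ u)) : edgeHomotopy A (bas m • fox u) = 0 := by
  induction u using List.reverseRecOn with
  | nil => simp
  | append_singleton u x ih =>
    have h' : Reduced ((nf m ++ u) ++ [x]) := by simpa using h
    rw [fox_append, smul_add, map_add, ih h'.left, zero_add, bas_smul_smul, fox_singleton,
      edgeHomotopy_single, edgeCell_of_reduced]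
    rwa [nf_mul_cls_of_reduced h'.left]

/-- The loop labelled `s⋆ s` at `q s` has exactly one edge outside the spanning tree of normal
forms, its last one, provided that `q` does not end in `s⋆`. -/
lemma edgeHomotopy_loop {s q : List (A ⊕ A)} (hs : Prime s) {c : FreeRegularStarMonoid A}
    (hc : nf c = q ++ s) (hq : ∀ q', q ≠ q' ++ star s) :
    edgeHomotopy A (bas c • fox (star s ++ s)) = cell s c := by
  have hr : Reduced (q ++ s) := hc ▸ reduced_nf c
  have h1 : Reduced (q ++ s ++ star s) := reduced_append_star hs hr s [] rfl (Or.inr hq)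
  obtain ⟨s', x, hx⟩ := List.eq_nil_or_concat s |>.resolve_left hs.ne_nil
  have hx' : star s = [x.swap] ++ star s' := by simp [hx, star]
  have h2 : Reduced (q ++ s ++ star s ++ s') := by
    have := reduced_append_star (prime_star hs) h1 (star s') [x.swap] hx' (by simp)
    rwa [star_star] at this
  have h3 : nf c ++ (star s ++ s') = q ++ s ++ star s ++ s' := by simp [hc]
  have h4 : star s ++ s = (star s ++ s') ++ [x] := by
    conv_lhs => rw [hx]
    rw [hx]
    simp
  rw [h4, fox_append, smul_add, map_add, edgeHomotopy_path (by rwa [h3]), zero_add, bas_smul_smul,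
    fox_singleton, edgeHomotopy_single, edgeCell_eq (q := q) (s := s) hs.ne_nil, ← hc, cls_nf]
  rw [nf_mul_cls_of_reduced (by rwa [h3]), h3]
  conv_rhs => enter [2, 2, 2]; rw [hx]
  simp

/-- The loop labelled `w⋆ w` at `m w` has exactly one edge outside the spanning tree: it is the last
edge of that loop, or the last edge of the same loop traversed from `m w w⋆`. -/
lemma homotopy_relator (w : {w : List (A ⊕ A) // Positive w}) (m : FreeRegularStarMonoid A) :
    edgeHomotopy A (bas (m * cls w.1) • fox (star w.1 ++ w.1)) =
      bas (m * cls w.1 * cls (star w.1)) • Finsupp.single w 1 := by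
  obtain ⟨w, hpos⟩ := w
  have hw := hpos.prime
  dsimp only
  set n := m * cls w with hn
  have hnw : n * cls (star w) * cls w = n := by
    rw [hn, mul_assoc, mul_assoc, ← mul_assoc (cls w), cls_mul_star_mul]
  obtain ⟨q, hq⟩ : ∃ q, nf n = q ++ w := by
    rw [hn, nf_mul_cls]
    exact exists_act_eq_append hw.reduced hw.no_prefix (reduced_nf m)
  by_cases h : ∃ q', q = q' ++ star w
  · -- the loop is traversed from the other base point `n w⋆`, with label `w w⋆`
    obtain ⟨q', rfl⟩ := h
    have hr : Reduced (q' ++ star w ++ w) := hq ▸ reduced_nf n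
    have h1 : nf (n * cls (star w)) = q' ++ star w := by
      rw [nf_mul_cls, hq, act_star_of_suffix hw hr]
    have h2 := edgeHomotopy_loop (prime_star hw) h1
      (by rw [star_star]; exact not_suffix_of_reduced hw.ne_nil hr)
    rw [star_star, cell, dif_neg hpos.not_star, dif_pos (by rwa [star_star])] at h2
    have h3 : bas n • fox (star w ++ w) = bas (n * cls (star w)) • fox (w ++ star w) := by
      rw [fox_append, fox_append, smul_add, smul_add, bas_smul_smul, bas_smul_smul, hnw, add_comm]
    rw [h3, h2]
    simp only [star_star]
  · push Not at h
    rw [edgeHomotopy_loop hw hq h, cell, dif_pos hpos]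

/-- Exactness at the relators: the kernel of the boundary is the kernel of an idempotent. -/
lemma homotopy_relators (l : Relators A) :
    edgeHomotopy A (relatorBoundary A l) = relatorProj A l := by
  have : (edgeHomotopy A).comp (relatorBoundary A).toAddMonoidHom =
      (relatorProj A).toAddMonoidHom := by
    apply finsupp_addHom_ext
    intro w m
    have h1 := relatorBoundary_single m w
    have h2 := relatorProj_single m w
    simp only [AddMonoidHom.comp_apply, LinearMap.toAddMonoidHom_coe, h1, h2, homotopy_relator]
  exact DFunLike.congr_fun this l

/-! ### Cohomological dimension two from a short resolution -/

section Ext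

open Abelian Limits

universe w v v'

variable {C : Type v} [Category.{v'} C] [Abelian C] [HasExt.{w} C]

lemma subsingleton_ext_of_iso {X X' : C} (e : X ≅ X') {Y : C} {n : ℕ}
    (h : ∀ x : Ext X Y n, x = 0) : Subsingleton (Ext X' Y n) := by
  refine subsingleton_of_forall_eq 0 fun x => ?_
  have h1 := Ext.mk₀_comp_mk₀_assoc e.inv e.hom x
  rw [h ((Ext.mk₀ e.hom).comp x (zero_add n)), Ext.comp_zero, Iso.inv_hom_id, Ext.mk₀_id_comp] at h1
  exact h1.symm

/-- An object with a projective resolution of length two has no cohomology above degree two. -/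
lemma ext_eq_zero_of_shortExact {S T : ShortComplex C} (hS : S.ShortExact) (hT : T.ShortExact)
    (e : T.X₃ = S.X₁) [Projective S.X₂] [Projective T.X₂] [Projective T.X₁] {Y : C} {n : ℕ}
    (x : Ext S.X₃ Y (n + 3)) : x = 0 := by
  obtain ⟨y, rfl⟩ := Ext.contravariant_sequence_exact₃ hS Y x (Ext.eq_zero_of_projective _)
    (show 1 + (n + 2) = n + 3 by omega)
  have hy : ∀ z : Ext T.X₃ Y (n + 2), z = 0 := by
    intro z
    obtain ⟨t, rfl⟩ := Ext.contravariant_sequence_exact₃ hT Y z (Ext.eq_zero_of_projective _)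
      (show 1 + (n + 1) = n + 2 by omega)
    rw [Ext.eq_zero_of_projective t, Ext.comp_zero]
  rw [e] at hy
  rw [hy y, Ext.comp_zero]

/-- In a two-term resolution, a morphism from the second syzygy which does not extend to the
projective containing it represents a nonzero class in degree two. -/
lemma exists_ext_ne_zero_of_shortExact {X₀ X₁ X₂ P₀ P₁ : C} {f : X₁ ⟶ P₀} {g : P₀ ⟶ X₀}
    {f' : X₂ ⟶ P₁} {g' : P₁ ⟶ X₁} {w₁ : f ≫ g = 0} {w₂ : f' ≫ g' = 0}
    (hS : (ShortComplex.mk f g w₁).ShortExact) (hT : (ShortComplex.mk f' g' w₂).ShortExact)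
    [Projective P₀] {Y : C} (φ : X₂ ⟶ Y) (hφ : ∀ ψ : P₁ ⟶ Y, f' ≫ ψ ≠ φ) :
    ∃ x : Ext X₀ Y 2, x ≠ 0 := by
  refine ⟨hS.extClass.comp (hT.extClass.comp (Ext.mk₀ φ) (show 1 + 0 = 1 by rfl))
    (show 1 + 1 = 2 by rfl), fun h => ?_⟩
  obtain ⟨y, hy⟩ := Ext.contravariant_sequence_exact₁ hS Y _ _ h
  have hy0 : y = 0 := Ext.eq_zero_of_projective y
  rw [hy0, Ext.comp_zero] at hy
  obtain ⟨z, hz⟩ := Ext.contravariant_sequence_exact₁ hT Y _ _ hy.symm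
  obtain ⟨ψ, rfl⟩ := Ext.mk₀_bijective _ _ |>.2 z
  rw [Ext.mk₀_comp_mk₀] at hz
  exact hφ ψ ((Ext.mk₀_bijective _ _).1 hz)

end Ext

/-! ### The resolution as short exact sequences -/

/-- The second syzygy: the `1`-cycles of the right Cayley graph. -/
noncomputable abbrev Cycles (A : Type) : Submodule (MonoidRing A) (Edges A) :=
  LinearMap.ker (edgeBoundary A)

lemma relatorBoundary_edgeHomotopy {k : Edges A} (hk : k ∈ Cycles A) :
    relatorBoundary A (edgeHomotopy A k) = k := by
  have h := homotopy_edges k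
  rwa [LinearMap.mem_ker.1 hk, map_zero, add_zero] at h

/-- On cycles, the contracting homotopy is linear over the monoid ring. -/
noncomputable def cyclesSection (A : Type) : Cycles A →ₗ[MonoidRing A] Relators A where
  toFun k := edgeHomotopy A k.1
  map_add' k l := by simp
  map_smul' r k := by
    have h : r • k.1 = relatorBoundary A (r • edgeHomotopy A k.1) := by
      rw [map_smul, relatorBoundary_edgeHomotopy k.2]
    have h' : edgeHomotopy A k.1 = relatorProj A (edgeHomotopy A k.1) := by
      rw [← homotopy_relators, relatorBoundary_edgeHomotopy k.2]
    rw [SetLike.val_smul, h, homotopy_relators, map_smul, ← h', RingHom.id_apply]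

/-- The cycles are a direct summand of the free module of relators. -/
instance : Module.Projective (MonoidRing A) (Cycles A) :=
  Module.Projective.of_split (cyclesSection A)
    ((relatorBoundary A).codRestrict (Cycles A) edgeBoundary_relatorBoundary) (by
      ext1 k
      exact Subtype.ext (relatorBoundary_edgeHomotopy k.2))

/-- The trivial module `ℤ`. -/
noncomputable def Triv (A : Type) : ModuleCat.{0} (MonoidRing A) :=
  leftTrivial (FreeRegularStarMonoid A) ℤ

/-- The underlying group of the trivial module `ℤ`. -/
noncomputable def trivEquiv (A : Type) : Triv A ≃+ ℤ := AddEquiv.refl ℤ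

lemma trivEquiv_smul (r : MonoidRing A) (t : Triv A) :
    trivEquiv A (r • t) = augmentation (FreeRegularStarMonoid A) r * trivEquiv A t := rfl

/-- The augmentation as a linear map onto the trivial module. -/
noncomputable def augLinear (A : Type) : MonoidRing A →ₗ[MonoidRing A] Triv A where
  toFun r := (trivEquiv A).symm (augmentation (FreeRegularStarMonoid A) r)
  map_add' r s := by simp
  map_smul' r s := by
    apply (trivEquiv A).injective
    rw [RingHom.id_apply, trivEquiv_smul, smul_eq_mul, map_mul, AddEquiv.apply_symm_apply,
      AddEquiv.apply_symm_apply]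

lemma trivEquiv_augLinear (r : MonoidRing A) :
    trivEquiv A (augLinear A r) = augmentation (FreeRegularStarMonoid A) r :=
  (trivEquiv A).apply_symm_apply _

lemma bas_smul_triv (m : FreeRegularStarMonoid A) (t : Triv A) : bas m • t = t := by
  apply (trivEquiv A).injective
  rw [trivEquiv_smul, augmentation_bas, one_mul]

lemma augLinear_edgeBoundary (k : Edges A) : augLinear A (edgeBoundary A k) = 0 := by
  have : (augLinear A).comp (edgeBoundary A) = 0 := by
    apply Finsupp.lhom_ext'
    intro x
    ext
    have h : augLinear A (bas (cls [x]) - 1) = 0 := by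
      apply (trivEquiv A).injective
      rw [trivEquiv_augLinear, ← bas_one, map_sub, augmentation_bas, augmentation_bas, sub_self,
        map_zero]
    simpa [edgeBoundary] using h
  exact LinearMap.congr_fun this k

/-- `0 → I → ℤM → ℤ → 0`, with `I` the augmentation ideal. -/
noncomputable def augSequence (A : Type) : ShortComplex (ModuleCat.{0} (MonoidRing A)) :=
  (augLinear A).shortComplexKer

lemma augSequence_shortExact : (augSequence A).ShortExact := by
  apply LinearMap.shortExact_shortComplexKer
  intro n
  refine ⟨trivEquiv A n • (1 : MonoidRing A), (trivEquiv A).injective ?_⟩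
  rw [trivEquiv_augLinear]
  simp

/-- The boundary of edges, as a map to the augmentation ideal. -/
noncomputable def edgeBoundary' (A : Type) : Edges A →ₗ[MonoidRing A] LinearMap.ker (augLinear A) :=
  (edgeBoundary A).codRestrict _ augLinear_edgeBoundary

/-- `0 → K → P → I → 0`, with `P` the module of edges and `K` the module of cycles. -/
noncomputable def cycleSequence (A : Type) : ShortComplex (ModuleCat.{0} (MonoidRing A)) where
  X₁ := ModuleCat.of (MonoidRing A) (Cycles A)
  X₂ := ModuleCat.of (MonoidRing A) (Edges A)
  X₃ := ModuleCat.of (MonoidRing A) (LinearMap.ker (augLinear A))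
  f := ModuleCat.ofHom (Cycles A).subtype
  g := ModuleCat.ofHom (edgeBoundary' A)
  zero := ModuleCat.hom_ext (LinearMap.ext fun k => Subtype.ext k.2)

lemma cycleSequence_shortExact : (cycleSequence A).ShortExact where
  exact := by
    rw [ShortComplex.ShortExact.moduleCat_exact_iff_function_exact]
    intro k
    constructor
    · intro h
      exact ⟨⟨k, congrArg Subtype.val h⟩, rfl⟩
    · rintro ⟨k, rfl⟩
      exact Subtype.ext k.2
  mono_f := (ModuleCat.mono_iff_injective _).2 Subtype.val_injective
  epi_g := (ModuleCat.epi_iff_surjective _).2 (by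
    rintro ⟨r, hr⟩
    refine ⟨vertexHomotopy A r, Subtype.ext ?_⟩
    change edgeBoundary A (vertexHomotopy A r) = r
    have h : augmentation (FreeRegularStarMonoid A) r = 0 := by
      rw [← trivEquiv_augLinear, LinearMap.mem_ker.1 hr, map_zero]
    rw [edgeBoundary_vertexHomotopy, h, zero_smul, sub_zero])

/-! ### A nontrivial class in degree two -/

lemma reduced_of_length_le_two {t : List (A ⊕ A)} (h : t.length ≤ 2) : Reduced t := by
  rintro p v q rfl
  simp at h
  exact List.length_eq_zero_iff.1 (by omega)

lemma prime_singleton (x : A ⊕ A) : Prime [x] where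
  ne_nil := by simp
  reduced := reduced_of_length_le_two (by simp)
  no_prefix y z h := by
    have := congrArg List.length h
    simp at this
    exact List.length_eq_zero_iff.1 (by omega)
  no_suffix y z h := by
    have := congrArg List.length h
    simp at this
    exact List.length_eq_zero_iff.1 (by omega)

lemma pair_ne_append_star (x : A ⊕ A) {y : List (A ⊕ A)} (h : [x, x] = y ++ star y) : False := by
  have hl := congrArg List.length h
  simp at hl
  obtain ⟨a, rfl⟩ := List.length_eq_one_iff.1 (show y.length = 1 by omega)
  simp [star] at h
  obtain ⟨rfl, h⟩ := h
  cases x <;> simp at h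

lemma prime_pair (x : A ⊕ A) : Prime [x, x] where
  ne_nil := by simp
  reduced := reduced_of_length_le_two (by simp)
  no_prefix y z h := by
    have hl := congrArg List.length h
    simp at hl
    by_contra hy
    have := List.length_pos_iff.2 hy
    obtain rfl : z = [] := List.length_eq_zero_iff.1 (by omega)
    exact pair_ne_append_star x (by simpa using h)
  no_suffix y z h := by
    have hl := congrArg List.length h
    simp at hl
    by_contra hy
    have := List.length_pos_iff.2 hy
    obtain rfl : z = [] := List.length_eq_zero_iff.1 (by omega)
    exact pair_ne_append_star x (by simpa using h)

/-- The cocycle with value `0` on the relators of letters and `1` on all others. -/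
noncomputable def cocycle (A : Type) : Cycles A →ₗ[MonoidRing A] Triv A :=
  (Finsupp.linearCombination (MonoidRing A) fun w : {w : List (A ⊕ A) // Positive w} =>
    (trivEquiv A).symm (if w.1.length = 1 then 0 else 1)).comp (cyclesSection A)

/-- The cocycle as a morphism of modules. -/
noncomputable def cocycleHom (A : Type) : (cycleSequence A).X₁ ⟶ Triv A :=
  ModuleCat.ofHom (Y := (Triv A : Type)) (cocycle A)

lemma cocycle_relator (w : {w : List (A ⊕ A) // Positive w}) (k : Cycles A)
    (hk : k.1 = relatorBoundary A (Finsupp.single w 1)) :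
    trivEquiv A (cocycle A k) = if w.1.length = 1 then 0 else 1 := by
  have h : cyclesSection A k = bas (cls w.1 * cls (star w.1)) • Finsupp.single w 1 := by
    change edgeHomotopy A k.1 = _
    rw [hk, homotopy_relators]
    have := relatorProj_single 1 w
    rwa [bas_one, one_smul, one_mul] at this
  rw [cocycle, LinearMap.comp_apply, h, map_smul, bas_smul_triv,
    Finsupp.linearCombination_single, one_smul, AddEquiv.apply_symm_apply]

lemma map_fox (f : Edges A →ₗ[MonoidRing A] Triv A) (w : List (A ⊕ A)) :
    trivEquiv A (f (fox w)) = (w.map fun x => trivEquiv A (f (Finsupp.single x 1))).sum := by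
  induction w with
  | nil => simp
  | cons x w ih =>
    rw [fox, map_add, map_smul, bas_smul_triv, map_add, ih, List.map_cons, List.sum_cons]

/-- The cocycle does not extend to edges: on a trivial module, an extension would take the relator
of `x x` to twice its value on the relator of the letter `x`. -/
lemma cocycle_not_extend (x : A ⊕ A) (f : Edges A →ₗ[MonoidRing A] Triv A) :
    ¬ ∀ k : Cycles A, f k.1 = cocycle A k := by
  intro hf
  have key : ∀ w : List (A ⊕ A), Positive w →
      ((star w ++ w).map fun x => trivEquiv A (f (Finsupp.single x 1))).sum =
        if w.length = 1 then 0 else 1 := by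
    intro w hw
    have h1 := hf ⟨relatorBoundary A (Finsupp.single ⟨w, hw⟩ 1), edgeBoundary_relatorBoundary _⟩
    replace h1 := congrArg (trivEquiv A) h1
    rw [cocycle_relator ⟨w, hw⟩ _ rfl] at h1
    have h2 := relatorBoundary_single 1 (⟨w, hw⟩ : {w : List (A ⊕ A) // Positive w})
    rw [bas_one, one_smul] at h2
    dsimp only at h1
    rw [h2, map_smul, bas_smul_triv, map_fox] at h1
    exact h1
  have key' : ∀ w : List (A ⊕ A), Prime w →
      ((star w ++ w).map fun x => trivEquiv A (f (Finsupp.single x 1))).sum =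
        if w.length = 1 then 0 else 1 := by
    intro w hw
    rcases hw.positive_or with h | h
    · exact key w h
    · have := key _ h
      rw [star_star, length_star] at this
      rw [← this, List.map_append, List.map_append, List.sum_append, List.sum_append, add_comm]
  have h1 := key' _ (prime_singleton x)
  have h2 := key' _ (prime_pair x)
  simp [star] at h1 h2
  omega

/-! ### Transport along exact functors -/

section Transport

universe w v v'

open Abelian

variable {C : Type v} [Category.{v'} C] [Abelian C] [HasExt.{w} C]
  (G : ModuleCat.{0} (MonoidRing A) ⥤ C) [G.Additive] [Limits.PreservesFiniteLimits G]
  [Limits.PreservesFiniteColimits G] [G.PreservesProjectiveObjects]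

instance : Projective (augSequence A).X₂ :=
  (IsProjective.iff_projective _).1
    (inferInstanceAs (Module.Projective (MonoidRing A) (MonoidRing A)))

instance : Projective (cycleSequence A).X₂ :=
  (IsProjective.iff_projective _).1 (inferInstanceAs (Module.Projective (MonoidRing A) (Edges A)))

instance : Projective (cycleSequence A).X₁ :=
  (IsProjective.iff_projective _).1 (inferInstanceAs (Module.Projective (MonoidRing A) (Cycles A)))

/-- The functor `G` serves to change the universe and to pass from left to right modules. -/
lemma subsingleton_ext_of_two_lt {Z : C} (e : G.obj (Triv A) ≅ Z) (Y : C) {q : ℕ} (hq : 2 < q) :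
    Subsingleton (Ext Z Y q) := by
  obtain ⟨n, rfl⟩ := Nat.exists_eq_add_of_lt hq
  have hS := (augSequence_shortExact (A := A)).map_of_exact G
  have hT := (cycleSequence_shortExact (A := A)).map_of_exact G
  have : Projective ((augSequence A).map G).X₂ := G.projective_obj (augSequence A).X₂
  have : Projective ((cycleSequence A).map G).X₂ := G.projective_obj (cycleSequence A).X₂
  have : Projective ((cycleSequence A).map G).X₁ := G.projective_obj (cycleSequence A).X₁
  obtain ⟨q', hq'⟩ : ∃ q', 2 + n + 1 = q' + 3 := ⟨n, by omega⟩
  rw [hq']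
  exact subsingleton_ext_of_iso e fun x => ext_eq_zero_of_shortExact hS hT rfl x

lemma nontrivial_ext_two [G.Full] [G.Faithful] [Nonempty A] {Z Y : C} (e : G.obj (Triv A) ≅ Z)
    (e' : G.obj (Triv A) ≅ Y) : Nontrivial (Ext Z Y 2) := by
  by_contra hcon
  rw [not_nontrivial_iff_subsingleton] at hcon
  have hS := (augSequence_shortExact (A := A)).map_of_exact G
  have hT := (cycleSequence_shortExact (A := A)).map_of_exact G
  have : Projective (G.obj (augSequence A).X₂) := G.projective_obj (augSequence A).X₂
  obtain ⟨a⟩ := ‹Nonempty A›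
  obtain ⟨x, hx⟩ := exists_ext_ne_zero_of_shortExact (X₀ := G.obj (Triv A)) hS hT
    (G.map (cocycleHom A) ≫ e'.hom) (by
      intro ψ hψ
      obtain ⟨ψ', hψ'⟩ := G.map_surjective (ψ ≫ e'.inv)
      have h : (cycleSequence A).f ≫ ψ' = cocycleHom A := by
        apply G.map_injective
        rw [G.map_comp, hψ', ← Category.assoc]
        exact (Iso.comp_inv_eq e').2 hψ
      refine cocycle_not_extend (Sum.inl a) ψ'.hom fun k => ?_
      exact LinearMap.congr_fun (congrArg ModuleCat.Hom.hom h) k)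
  refine hx ?_
  have := subsingleton_ext_of_iso e.symm (Y := Y) (n := 2) fun x => Subsingleton.elim _ _
  exact Subsingleton.elim _ _

end Transport

/-! ### The star as an isomorphism with the opposite ring -/

/-- The involution of the free regular star-monoid, as an anti-automorphism. -/
noncomputable def starHom (A : Type) : FreeRegularStarMonoid A →* (FreeRegularStarMonoid A)ᵐᵒᵖ :=
  PresentedMonoid.lift (fun x => MulOpposite.op (cls [x.swap])) (by
    have h : ∀ w : List (A ⊕ A), FreeMonoid.lift (fun x => MulOpposite.op (cls [x.swap]))
        (FreeMonoid.ofList w) = MulOpposite.op (cls (star w)) := by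
      intro w
      induction w with
      | nil => rfl
      | cons x w ih =>
        have hx : star (x :: w) = star w ++ [x.swap] := by simp [star]
        rw [FreeMonoid.ofList_cons, map_mul, ih, hx, cls_append, MulOpposite.op_mul]
        rfl
    have hrel : ∀ w : List (A ⊕ A), FreeMonoid.lift (fun x => MulOpposite.op (cls [x.swap]))
        (FreeMonoid.ofList (w ++ star w ++ w)) =
          FreeMonoid.lift (fun x => MulOpposite.op (cls [x.swap])) (FreeMonoid.ofList w) := by
      intro w
      rw [h, h, ← cls_mul_star_mul (star w)]
      simp [mul_assoc]
    rintro _ w ⟨⟩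
    exact hrel w)

lemma starHom_cls (w : List (A ⊕ A)) : starHom A (cls w) = MulOpposite.op (cls (star w)) := by
  induction w with
  | nil => rfl
  | cons x w ih =>
    have hx : star (x :: w) = star w ++ [x.swap] := by simp [star]
    rw [cls_cons, map_mul, ih, hx, cls_append, MulOpposite.op_mul]
    rfl

/-- The involution, as an isomorphism from the opposite monoid. -/
noncomputable def starEquiv (A : Type) :
    (FreeRegularStarMonoid A)ᵐᵒᵖ ≃* FreeRegularStarMonoid A :=
  MulEquiv.symm
    { starHom A with
      invFun := fun m => (starHom A m.unop).unop
      left_inv := by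
        intro m
        obtain ⟨w, rfl⟩ := cls_surjective m
        change (starHom A (starHom A (cls w)).unop).unop = cls w
        rw [starHom_cls, MulOpposite.unop_op, starHom_cls, star_star, MulOpposite.unop_op]
      right_inv := by
        intro m
        obtain ⟨w, hw⟩ := cls_surjective m.unop
        apply MulOpposite.unop_injective
        change (starHom A (starHom A m.unop).unop).unop = m.unop
        rw [← hw, starHom_cls, MulOpposite.unop_op, starHom_cls, star_star, MulOpposite.unop_op] }

/-- The involution, as a ring isomorphism from the opposite of the monoid ring. -/
noncomputable def ringStar (A : Type) : (MonoidRing A)ᵐᵒᵖ ≃+* MonoidRing A :=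
  let e₁ : (MonoidRing A)ᵐᵒᵖ ≃+* MonoidAlgebra ℤᵐᵒᵖ (FreeRegularStarMonoid A)ᵐᵒᵖ :=
    MonoidAlgebra.opRingEquiv
  let e₂ : MonoidAlgebra ℤᵐᵒᵖ (FreeRegularStarMonoid A)ᵐᵒᵖ ≃+*
      MonoidAlgebra ℤ (FreeRegularStarMonoid A)ᵐᵒᵖ :=
    MonoidAlgebra.mapRingEquiv _ (RingEquiv.toOpposite ℤ).symm
  (e₁.trans e₂).trans (MonoidAlgebra.mapDomainRingEquiv ℤ (starEquiv A))

lemma augmentation_ringStar (r : (MonoidRing A)ᵐᵒᵖ) :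
    augmentation (FreeRegularStarMonoid A) (ringStar A r) =
      augmentationOp (FreeRegularStarMonoid A) r := by
  have : ((augmentation (FreeRegularStarMonoid A)).toAddMonoidHom.comp
      (ringStar A).toAddMonoidHom).comp
        (MulOpposite.opAddEquiv : MonoidRing A ≃+ _).toAddMonoidHom =
      ((augmentationOp (FreeRegularStarMonoid A)).toAddMonoidHom).comp
        (MulOpposite.opAddEquiv : MonoidRing A ≃+ _).toAddMonoidHom := by
    apply ring_addHom_ext
    intro m
    have h1 : ringStar A (MulOpposite.op (bas m)) = bas (starEquiv A (MulOpposite.op m)) := by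
      simp [ringStar, bas]
    have h2 : augmentationOp (FreeRegularStarMonoid A) (MulOpposite.op (bas m)) = 1 :=
      augmentation_bas m
    change augmentation _ (ringStar A (MulOpposite.op (bas m))) = augmentationOp _ _
    rw [h1, augmentation_bas]
    exact h2.symm
  exact DFunLike.congr_fun this r.unop

/-! ### Left and right cohomology -/

/-- The left trivial module `ℤ` in a larger universe. -/
noncomputable def leftTrivULift (A : Type) : ModuleCat.{u} (MonoidRing A) :=
  leftTrivial (FreeRegularStarMonoid A) (ULift.{u} ℤ)

/-- The right trivial module `ℤ` in a larger universe. -/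
noncomputable def rightTrivULift (A : Type) : ModuleCat.{u} (MonoidRing A)ᵐᵒᵖ :=
  rightTrivial (FreeRegularStarMonoid A) (ULift.{u} ℤ)

/-- Left modules of the lowest universe, as right modules of a larger universe. -/
noncomputable abbrev toRight (A : Type) :
    ModuleCat.{0} (MonoidRing A) ⥤ ModuleCat.{u} (MonoidRing A)ᵐᵒᵖ :=
  ModuleCat.uliftFunctor.{u, 0} (MonoidRing A) ⋙
    (ModuleCat.restrictScalarsEquivalenceOfRingEquiv (ringStar A)).functor

/-- The left trivial module `ℤ`, as a right module by means of the involution. -/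
noncomputable def toRightTriv (A : Type) : ModuleCat.{u} (MonoidRing A)ᵐᵒᵖ :=
  (toRight.{u} A).obj (Triv A)

/-- Lifting the left trivial module `ℤ` to a larger universe gives the left trivial module. -/
noncomputable def leftTrivIso (A : Type) :
    (ModuleCat.uliftFunctor.{u, 0} (MonoidRing A)).obj (Triv A) ≅ leftTrivULift.{u} A :=
  let e : ULift.{u} (Triv A) ≃ₗ[MonoidRing A] leftTrivULift.{u} A :=
    { toFun := fun x => ULift.up (trivEquiv A x.down)
      invFun := fun x => ULift.up ((trivEquiv A).symm (ULift.down (α := ℤ) x))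
      map_add' := fun _ _ => rfl
      map_smul' := fun _ _ => rfl
      left_inv := fun _ => rfl
      right_inv := fun _ => rfl }
  e.toModuleIso

/-- The involution takes the left trivial module `ℤ` to the right trivial module `ℤ`. -/
noncomputable def rightTrivIso (A : Type) : toRightTriv.{u} A ≅ rightTrivULift.{u} A :=
  let e : toRightTriv.{u} A ≃ₗ[(MonoidRing A)ᵐᵒᵖ] rightTrivULift.{u} A :=
    { toFun := fun x => ULift.up (trivEquiv A (ULift.down (α := Triv A) x))
      invFun := fun x => ULift.up ((trivEquiv A).symm (ULift.down (α := ℤ) x))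
      map_add' := fun _ _ => rfl
      map_smul' := fun r x => by
        apply ULift.down_injective
        change augmentation _ (ringStar A r) * _ = augmentationOp _ r * _
        rw [augmentation_ringStar]
        rfl
      left_inv := fun _ => rfl
      right_inv := fun _ => rfl }
  e.toModuleIso

lemma sInf_eq_two {V : ℕ → Prop} (h2 : ∀ q, 2 < q → V q) (h : ¬ V 2) :
    sInf {k : ℕ∞ | ∀ q : ℕ, k < q → V q} = 2 := by
  apply le_antisymm
  · exact sInf_le fun q hq => h2 q (by exact_mod_cast hq)
  · refine le_sInf fun k hk => ?_
    by_contra hlt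
    exact h (hk 2 (not_le.1 hlt))

end StarWord

theorem mainTheorem5 (r : ℕ) (hr : 1 ≤ r) :
    (leftTcd.{u} (FreeRegularStarMonoid (Fin r)) = 2 ∧
      (∀ q : ℕ, 2 < q → ∀ (B : Type u) [AddCommGroup B],
        Subsingleton (LeftCohomology (FreeRegularStarMonoid (Fin r))
          (leftTrivial (FreeRegularStarMonoid (Fin r)) B) q)) ∧
      Nontrivial (LeftCohomology (FreeRegularStarMonoid (Fin r))
        (leftTrivial (FreeRegularStarMonoid (Fin r)) (ULift.{u} ℤ)) 2)) ∧
    (rightTcd.{u} (FreeRegularStarMonoid (Fin r)) = 2 ∧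
      (∀ q : ℕ, 2 < q → ∀ (B : Type u) [AddCommGroup B],
        Subsingleton (RightCohomology (FreeRegularStarMonoid (Fin r))
          (rightTrivial (FreeRegularStarMonoid (Fin r)) B) q)) ∧
      Nontrivial (RightCohomology (FreeRegularStarMonoid (Fin r))
        (rightTrivial (FreeRegularStarMonoid (Fin r)) (ULift.{u} ℤ)) 2)) := by
  have : Nonempty (Fin r) := ⟨⟨0, hr⟩⟩
  have hl : ∀ q : ℕ, 2 < q → ∀ (B : Type u) [AddCommGroup B],
      Subsingleton (LeftCohomology (FreeRegularStarMonoid (Fin r))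
        (leftTrivial (FreeRegularStarMonoid (Fin r)) B) q) := fun q hq B _ =>
    StarWord.subsingleton_ext_of_two_lt _ (StarWord.leftTrivIso.{u} (Fin r)) _ hq
  have hl2 : Nontrivial (LeftCohomology (FreeRegularStarMonoid (Fin r))
      (leftTrivial (FreeRegularStarMonoid (Fin r)) (ULift.{u} ℤ)) 2) :=
    StarWord.nontrivial_ext_two _ (StarWord.leftTrivIso.{u} (Fin r))
      (StarWord.leftTrivIso.{u} (Fin r))
  have hright : ∀ q : ℕ, 2 < q → ∀ (B : Type u) [AddCommGroup B],
      Subsingleton (RightCohomology (FreeRegularStarMonoid (Fin r))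
        (rightTrivial (FreeRegularStarMonoid (Fin r)) B) q) := fun q hq B _ =>
    StarWord.subsingleton_ext_of_two_lt (StarWord.toRight.{u} (Fin r))
      (StarWord.rightTrivIso.{u} (Fin r)) _ hq
  have hright2 : Nontrivial (RightCohomology (FreeRegularStarMonoid (Fin r))
      (rightTrivial (FreeRegularStarMonoid (Fin r)) (ULift.{u} ℤ)) 2) :=
    StarWord.nontrivial_ext_two (StarWord.toRight.{u} (Fin r)) (StarWord.rightTrivIso.{u} (Fin r))
      (StarWord.rightTrivIso.{u} (Fin r))
  refine ⟨⟨StarWord.sInf_eq_two hl fun h => ?_, hl, hl2⟩,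
    ⟨StarWord.sInf_eq_two hright fun h => ?_, hright, hright2⟩⟩
  · exact not_subsingleton_iff_nontrivial.2 hl2 (h (ULift.{u} ℤ))
  · exact not_subsingleton_iff_nontrivial.2 hright2 (h (ULift.{u} ℤ))
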